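/- Let $0\le\alpha\le 1$, $\sigma,\tau>0$ with $\sigma+\tau\le 1$, $0<\gamma<1$, and let the movement probabilities satisfy $p_A=p_D\in[0,1]$. Consider the decision process $\mathcal D$ with states $\phi_0\in[0,1]$ (the fraction of group $D$) in which the admissible actions at $\phi_0$ are the thresholds $\theta_0\in[0,\sigma]$ for group $D$ with $\phi_0(1-\theta_0/\sigma)\le\alpha\le\phi_0(1-\theta_0/\sigma)+(1-\phi_0)$. Such a $\theta_0$ is completed by a threshold for group $A$: $\theta_1=\frac{\sigma(1-\alpha)+(1-\phi_0)\tau-\phi_0\theta_0}{1-\phi_0}$ if $\phi_0<1$, and any $\theta_1\in[\tau,\sigma+\tau]$ if $\phi_0=1$. The reward is $$R(\phi_0,\theta_0)=\frac{\phi_0}{2\sigma}(\sigma^2-\theta_0^2)+\frac{1-\phi_0}{2\sigma}\bigl((\sigma+\tau)^2-\theta_1^2\bigr),$$ and with $\phi^{\rm post}=\phi_0-\frac{\phi_0}{2\sigma}(\sigma^2-\theta_0^2)$ the next state is $S(\phi_0,\theta_0)=\phi^{\rm post}(1-p_D)+p_D(\phi^{\rm post})^2+p_A(1-\phi^{\rm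 post})\phi^{\rm post}$, which equals $\phi^{\rm post}$ since $p_A=p_D$. A policy $\pi$ chooses an admissible threshold at every state; $V_\pi(\phi_0)$ is its $\gamma$-discounted total reward from the initial state $\phi_0$; $\pi$ is optimal if $V_\pi(\phi_0)=\max_{\theta_0}\bigl(R(\phi_0,\theta_0)+\gamma V_\pi(S(\phi_0,\theta_0))\bigr)$ at every $\phi_0\in[0,1]$, the maximum being over the admissible thresholds at $\phi_0$. Let $\Pi^*_0(\phi_0)$ be the set of optimal thresholds for $D$ at $\phi_0$, that is, of the values $\pi(\phi_0)$ of optimal policies $\pi$, where in addition every threshold above $\sigma$ (which, like $\sigma$ itself, selects nobody from $D$) counts as optimal if $\sigma$ is. Let $\Pi^*_1(\phi_0)$ be the set of thresholds for $A$ that complete some $\theta_0\in\Pi^*_0(\phi_0)$, where a threshold above $\sigma$ is completed as $\sigma$ is. Put $$\phi^*_0=\max\left\{0,\min\left\{1-\alpha,\,1-\frac{\alpha\sigma}{2\tau}\left(1+\sqrt{1+\frac{2\tau\gamma}{1-\gamma}}\right)\right\}\right\}.$$ 1. For every state $0\le\phi_0\le\phi^*_0$ there are $\theta_0\in\Pi^*_0(\phi_0)$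 and $\theta_1\in\Pi^*_1(\phi_0)$, with $\theta_1$ completing $\theta_0$, such that $\theta_0=\theta_1$. 2. For every state $\phi^*_0<\phi_0<1$, all $\theta_0\in\Pi^*_0(\phi_0)$ and all $\theta_1\in\Pi^*_1(\phi_0)$ satisfy $\theta_0<\theta_1$. 3. If $\phi^*_0<1$, then at the state $\phi_0=1$, where group $A$ is empty and its threshold has no effect, every $\theta_0\in\Pi^*_0(1)$ has a completion $\theta_1\in\Pi^*_1(1)$ with $\theta_0<\theta_1$. -/

import Mathlib

noncomputable section

namespace OpportunityAllocation

/-- The parameters: capacity `α`, ability weight `σ`, bonus `τ` of the advantaged group, discount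
factor `γ`, and the movement probabilities of the two circumstances. -/
structure Params where
  α : ℝ
  σ : ℝ
  τ : ℝ
  γ : ℝ
  pA : ℝ
  pD : ℝ

variable (P : Params)

/-- The thresholds for group `D` that can be completed to an allocation of exactly an `α` fraction
of opportunities at the state `φ`: group `D` gets at most `α`, and group `D` together with all of
group `A` gets at least `α`. -/
def admissible (φ : ℝ) : Set ℝ :=
  {θ | 0 ≤ θ ∧ θ ≤ P.σ ∧ φ * (1 - θ / P.σ) ≤ P.α ∧ P.α ≤ φ * (1 - θ / P.σ) + (1 - φ)}

/-- The thresholds for group `A` that use up the capacity when group `D` has threshold `θ₀`. When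
group `A` is empty, every threshold between `τ` and `σ + τ` does. -/
def matching (φ θ₀ : ℝ) : Set ℝ :=
  {θ₁ | if φ = 1 then P.τ ≤ θ₁ ∧ θ₁ ≤ P.σ + P.τ
    else θ₁ = (P.σ * (1 - P.α) + (1 - φ) * P.τ - φ * θ₀) / (1 - φ)}

/-- The fraction of disadvantaged agents after the opportunities took effect and before
the next generation inherits. -/
def postState (φ θ₀ : ℝ) : ℝ :=
  φ - φ / (2 * P.σ) * (P.σ ^ 2 - θ₀ ^ 2)

/-- The state transition. -/
def nextState (φ θ₀ : ℝ) : ℝ :=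
  postState P φ θ₀ * (1 - P.pD) + postState P φ θ₀ * P.pD * postState P φ θ₀
    + (1 - postState P φ θ₀) * P.pA * postState P φ θ₀

/-- For equal movement probabilities the transition does not depend on them. -/
theorem nextState_of_eq (h : P.pA = P.pD) (φ θ₀ : ℝ) :
    nextState P φ θ₀ = φ - φ / (2 * P.σ) * (P.σ ^ 2 - θ₀ ^ 2) := by
  unfold nextState
  rw [h]
  unfold postState
  ring

/-- The immediate reward, the fraction of the population that gets the opportunity and succeeds. -/
def reward (φ θ₀ : ℝ) : ℝ :=
  if φ = 1 then 1 / (2 * P.σ) * (P.σ ^ 2 - θ₀ ^ 2)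
  else φ / (2 * P.σ) * (P.σ ^ 2 - θ₀ ^ 2)
    + (1 - φ) / (2 * P.σ) * ((P.σ + P.τ) ^ 2
      - ((P.σ * (1 - P.α) + (1 - φ) * P.τ - φ * θ₀) / (1 - φ)) ^ 2)

/-- A deterministic policy chooses an admissible threshold at every state in `[0,1]`. (Its values
outside `[0,1]` are irrelevant, since the transition maps `[0,1]` to itself.) -/
def IsPolicy (π : ℝ → ℝ) : Prop :=
  ∀ φ ∈ Set.Icc (0 : ℝ) 1, π φ ∈ admissible P φ

/-- The states visited when the policy `π` is executed from the initial state `φ`. -/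
def trajectory (π : ℝ → ℝ) (φ : ℝ) : ℕ → ℝ
  | 0 => φ
  | t + 1 => nextState P (trajectory π φ t) (π (trajectory π φ t))

/-- The discounted reward of executing the policy `π` from the initial state `φ`. -/
def policyValue (π : ℝ → ℝ) (φ : ℝ) : ℝ :=
  ∑' t : ℕ, P.γ ^ t * reward P (trajectory P π φ t) (π (trajectory P π φ t))

/-- A policy is optimal if its value function satisfies the Bellman optimality equation. -/
def IsOptimal (π : ℝ → ℝ) : Prop :=
  IsPolicy P π ∧ ∀ φ ∈ Set.Icc (0 : ℝ) 1,
    IsGreatest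
      ((fun θ => reward P φ θ + P.γ * policyValue P π (nextState P φ θ)) '' admissible P φ)
      (policyValue P π φ)

/-- The optimal pairs of thresholds at a state. A threshold above `σ` for group `D` selects nobody
from `D`, exactly like the threshold `σ`, so it is optimal if and only if `σ` is. -/
def optimalPairs (φ : ℝ) : Set (ℝ × ℝ) :=
  {θ | (∃ π, IsOptimal P π ∧ π φ = min θ.1 P.σ) ∧ θ.2 ∈ matching P φ (min θ.1 P.σ)}

/-- The optimal thresholds for the disadvantaged group `D`. -/
def optimalD (φ : ℝ) : Set ℝ := Prod.fst '' optimalPairs P φ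

/-- The optimal thresholds for the advantaged group `A`. -/
def optimalA (φ : ℝ) : Set ℝ := Prod.snd '' optimalPairs P φ

/-- The tipping point. -/
def tippingPoint : ℝ :=
  max 0 (min (1 - P.α)
    (1 - P.α * P.σ / (2 * P.τ) * (1 + Real.sqrt (1 + 2 * P.τ * P.γ / (1 - P.γ)))))

end OpportunityAllocation

end

/-!
Equal movement probabilities make the state nonincreasing: it drops by the number of successful
members of `D`. Write `t(φ) = σ (1 - α) + (1 - φ) τ`. At a fixed state the reward is a downward
parabola in `θ₀` with vertex `t(φ)` (`reward_eq_sub_sq`), and the completing threshold `θ₁` satisfies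
`φ θ₀ + (1 - φ) θ₁ = t(φ)`; hence `θ₀ < θ₁` if and only if `θ₀ < t(φ)`.

Above the tipping point, an optimal `θ₀` is less than `t(φ)`, because the optimal value decreases at
least linearly in the state (`IsBellman.exists_decrease_rate`): lowering the threshold slightly
below the vertex costs a quadratic amount now and gains a linear amount later
(`IsGreedy.lt_commonThreshold`). Since every threshold above `σ` stands for `σ`, it must also be
excluded that `σ` is optimal. If it were, staying at `φ` forever would be optimal, and the marginal
loss of selecting a few members of `D` once would be nonnegative
(`IsGreedy.deviationLoss_nonneg`); the tipping point is where this loss changes sign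
(`Params.Valid.deviationLoss_zero_nonneg_iff`).

Up to the tipping point the marginal loss is nonnegative. It is a lower bound for the loss per
selected agent of every one-step deviation (`Params.Valid.deviationLoss_zero_le`), and the states
below `φ` are also below the tipping point, so staying is optimal (`IsBellman.isGreedy_σ`). The threshold completing `σ` is then at least `σ`, and it can be
used for `D` too, since it selects nobody from `D`.

Optimal policies exist because, in terms of the selected mass of `D`, the problem has compact action
sets that vary continuously with the state, so the Bellman operator contracts the continuous
functions (`Params.Valid.exists_isBellman`).
-/

noncomputable section

namespace OpportunityAllocation

open Set Topology Filter

/-! ### Discounted dynamic programming -/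

/-- A function that is bounded above, and each of whose values is at most a discounted later one,
is nonpositive. This replaces the contraction argument on spaces of merely bounded functions. -/
theorem nonpos_of_le_discounted {X : Type*} {S : Set X} {D : X → ℝ} {M γ : ℝ}
    (hγ₀ : 0 ≤ γ) (hγ₁ : γ < 1) (hb : ∀ x ∈ S, D x ≤ M)
    (h : ∀ x ∈ S, ∃ y ∈ S, D x ≤ γ * D y) : ∀ x ∈ S, D x ≤ 0 := by
  have key : ∀ n : ℕ, ∀ x ∈ S, D x ≤ γ ^ n * M := by
    intro n
    induction n with
    | zero => simpa using hb
    | succ n ih =>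
      intro x hx
      obtain ⟨y, hy, hxy⟩ := h x hx
      calc D x ≤ γ * D y := hxy
        _ ≤ γ * (γ ^ n * M) := mul_le_mul_of_nonneg_left (ih y hy) hγ₀
        _ = γ ^ (n + 1) * M := by ring
  intro x hx
  have hlim : Tendsto (fun n : ℕ => γ ^ n * M) atTop (𝓝 (0 * M)) :=
    (tendsto_pow_atTop_nhds_zero_of_lt_one hγ₀ hγ₁).mul_const M
  rw [zero_mul] at hlim
  exact ge_of_tendsto' hlim fun n => key n x hx

/-- The quotient `u ^ 2 / v` stays continuous at the zeros of `v`, where Lean gives it the value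
`0`, because it is squeezed between `0` and `v`. -/
theorem continuous_sq_div {X : Type*} [TopologicalSpace X] {u v : X → ℝ}
    (hu : Continuous u) (hv : Continuous v) (h₀ : ∀ x, 0 ≤ u x) (huv : ∀ x, u x ≤ v x) :
    Continuous fun x => u x ^ 2 / v x := by
  rw [continuous_iff_continuousAt]
  intro x
  by_cases hx : v x = 0
  · have hval : u x ^ 2 / v x = 0 := by simp [hx]
    rw [ContinuousAt, hval]
    refine tendsto_of_tendsto_of_tendsto_of_le_of_le tendsto_const_nhds
      (by simpa [hx] using hv.tendsto x)
      (fun y => div_nonneg (sq_nonneg _) ((h₀ y).trans (huv y))) fun y => ?_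
    have hv₀ := (h₀ y).trans (huv y)
    change u y ^ 2 / v y ≤ v y
    exact div_le_of_le_mul₀ hv₀ hv₀ (by nlinarith [h₀ y, huv y])
  · exact (hu.continuousAt.pow 2).div hv.continuousAt hx

/-- A discounted decision problem with compact states and actions and continuous rewards and
transitions has a continuous value function with attained maxima: the fixed point of the Bellman
operator, a contraction of `C(X, ℝ)`. -/
theorem exists_isGreatest_bellman {X S : Type*} [TopologicalSpace X] [CompactSpace X]
    [TopologicalSpace S] [CompactSpace S] [Nonempty S] {γ : ℝ} (hγ₀ : 0 ≤ γ) (hγ₁ : γ < 1)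
    {r : X → S → ℝ} {n : X → S → X} (hr : Continuous fun p : X × S => r p.1 p.2)
    (hn : Continuous fun p : X × S => n p.1 p.2) :
    ∃ V : C(X, ℝ), ∀ x, IsGreatest (range fun s => r x s + γ * V (n x s)) (V x) := by
  have hQ : ∀ V : C(X, ℝ), Continuous fun p : X × S => r p.1 p.2 + γ * V (n p.1 p.2) :=
    fun V => hr.add ((V.continuous.comp hn).const_mul γ)
  have hcont : ∀ V : C(X, ℝ),
      Continuous fun x => sSup ((fun s => r x s + γ * V (n x s)) '' univ) :=
    fun V => isCompact_univ.continuous_sSup (hQ V)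
  have hgr : ∀ (V : C(X, ℝ)) (x : X), IsGreatest (range fun s => r x s + γ * V (n x s))
      (sSup ((fun s => r x s + γ * V (n x s)) '' univ)) := by
    intro V x
    rw [image_univ]
    exact (isCompact_range ((hQ V).comp (Continuous.prodMk_right x))).isGreatest_sSup
      (range_nonempty _)
  let B : C(X, ℝ) → C(X, ℝ) := fun V => ⟨_, hcont V⟩
  have hle : ∀ (V W : C(X, ℝ)) (x : X), B V x - B W x ≤ γ * dist V W := by
    intro V W x
    obtain ⟨s, hs⟩ := (hgr V x).1
    have h₁ : r x s + γ * W (n x s) ≤ B W x := (hgr W x).2 ⟨s, rfl⟩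
    have h₂ : r x s + γ * V (n x s) = B V x := hs
    have h₃ : V (n x s) - W (n x s) ≤ dist V W :=
      (le_abs_self _).trans (by
        simpa only [Real.dist_eq] using ContinuousMap.dist_apply_le_dist (f := V) (g := W) (n x s))
    nlinarith [mul_le_mul_of_nonneg_left h₃ hγ₀]
  have hB : ContractingWith γ.toNNReal B := by
    refine ⟨by simpa using hγ₁, LipschitzWith.of_dist_le_mul fun V W => ?_⟩
    rw [Real.coe_toNNReal γ hγ₀, ContinuousMap.dist_le (mul_nonneg hγ₀ dist_nonneg)]
    intro x
    rw [Real.dist_eq, abs_le]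
    have := hle W V x
    rw [dist_comm] at this
    exact ⟨by change -(γ * dist V W) ≤ _; linarith, hle V W x⟩
  refine ⟨hB.fixedPoint B, fun x => ?_⟩
  have := hgr (hB.fixedPoint B) x
  have hfix : B (hB.fixedPoint B) x = hB.fixedPoint B x := by rw [hB.fixedPoint_isFixedPt]
  rwa [← hfix]

/-! ### Rewards and transitions -/

variable {P : Params}

/-- The standing assumptions on the parameters. The movement probabilities matter only through
their equality. -/
structure Params.Valid (P : Params) : Prop where
  α_nonneg : 0 ≤ P.α
  α_le_one : P.α ≤ 1
  σ_pos : 0 < P.σ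
  τ_pos : 0 < P.τ
  add_le_one : P.σ + P.τ ≤ 1
  γ_pos : 0 < P.γ
  γ_lt_one : P.γ < 1
  pA_eq_pD : P.pA = P.pD

/-- The threshold which, applied to both groups, uses up the capacity (the constraints
`θ ≤ σ` and `θ ≤ σ + τ` are ignored). A completed threshold `θ₀` of `D` lies below the matching
threshold of `A` exactly when it lies below this one. -/
def commonThreshold (P : Params) (φ : ℝ) : ℝ := P.σ * (1 - P.α) + (1 - φ) * P.τ

/-- A bounded solution on `[0, 1]` of the Bellman optimality equation, with attained maxima. -/
structure IsBellman (P : Params) (V : ℝ → ℝ) : Prop where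
  bounded : ∃ M, ∀ φ ∈ Icc (0 : ℝ) 1, |V φ| ≤ M
  isGreatest : ∀ φ ∈ Icc (0 : ℝ) 1,
    IsGreatest ((fun θ => reward P φ θ + P.γ * V (nextState P φ θ)) '' admissible P φ) (V φ)

/-- The threshold `θ` attains the maximum in the Bellman equation of `V` at the state `φ`. -/
def IsGreedy (P : Params) (V : ℝ → ℝ) (φ θ : ℝ) : Prop :=
  θ ∈ admissible P φ ∧ reward P φ θ + P.γ * V (nextState P φ θ) = V φ

/-- The reward in terms of the selected fraction `1 - θ / σ` of `D`. Only the last summand is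
singular in the state. -/
theorem reward_eq (hσ : P.σ ≠ 0) {φ : ℝ} (hφ : φ ≠ 1) (θ : ℝ) :
    reward P φ θ = (P.σ + P.τ) * P.α - P.τ * ((1 - θ / P.σ) * φ)
      - P.σ / 2 * (2 * P.α * (1 - θ / P.σ) - (1 - θ / P.σ) ^ 2
        + (P.α - (1 - θ / P.σ)) ^ 2 / (1 - φ)) := by
  have h : 1 - φ ≠ 0 := sub_ne_zero.2 hφ.symm
  rw [reward, if_neg hφ]
  field_simp
  ring

/-- At a fixed state the reward is a downward parabola in the threshold, with its vertex at the
common threshold: equal thresholds are myopically optimal. -/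
theorem reward_eq_sub_sq (hσ : P.σ ≠ 0) {φ : ℝ} (hφ : φ ≠ 1) (θ : ℝ) :
    reward P φ θ = (φ * P.σ ^ 2 + (1 - φ) * (P.σ + P.τ) ^ 2 - commonThreshold P φ ^ 2) / (2 * P.σ)
      - φ * (θ - commonThreshold P φ) ^ 2 / (2 * P.σ * (1 - φ)) := by
  have h : 1 - φ ≠ 0 := sub_ne_zero.2 hφ.symm
  rw [reward, if_neg hφ, commonThreshold]
  field_simp
  ring

/-- The gain in immediate reward from fewer disadvantaged agents, at the same threshold for `D`. -/
theorem reward_sub_reward (hσ : P.σ ≠ 0) {x y : ℝ} (hx : x ≠ 1) (hy : y ≠ 1) (θ : ℝ) :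
    reward P y θ - reward P x θ = (x - y) * (P.τ * (1 - θ / P.σ)
      + P.σ * (P.α - (1 - θ / P.σ)) ^ 2 / (2 * (1 - x) * (1 - y))) := by
  have h₁ : 1 - x ≠ 0 := sub_ne_zero.2 hx.symm
  have h₂ : 1 - y ≠ 0 := sub_ne_zero.2 hy.symm
  rw [reward_eq hσ hx, reward_eq hσ hy]
  generalize 1 - θ / P.σ = f
  field_simp
  ring

theorem Params.Valid.nextState_eq (h : P.Valid) (φ θ : ℝ) :
    nextState P φ θ = φ * (1 - (P.σ ^ 2 - θ ^ 2) / (2 * P.σ)) := by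
  rw [nextState_of_eq P h.pA_eq_pD]
  ring

/-- The fraction of `D` that becomes advantaged lies between `0` and `σ / 2`. -/
theorem Params.Valid.success_mem (h : P.Valid) {θ : ℝ} (h₀ : 0 ≤ θ) (h₁ : θ ≤ P.σ) :
    0 ≤ (P.σ ^ 2 - θ ^ 2) / (2 * P.σ) ∧ (P.σ ^ 2 - θ ^ 2) / (2 * P.σ) ≤ P.σ / 2 := by
  have hσ := h.σ_pos
  constructor
  · apply div_nonneg <;> nlinarith
  · rw [div_le_iff₀ (by positivity)]
    nlinarith

theorem Params.Valid.nextState_nonneg (h : P.Valid) {φ θ : ℝ} (hφ : 0 ≤ φ)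
    (hθ : θ ∈ admissible P φ) : 0 ≤ nextState P φ θ := by
  rw [h.nextState_eq]
  have h₁ := h.success_mem hθ.1 hθ.2.1
  exact mul_nonneg hφ (by linarith [h.add_le_one, h.τ_pos, h.σ_pos])

theorem Params.Valid.nextState_le (h : P.Valid) {φ θ : ℝ} (hφ : 0 ≤ φ)
    (hθ : θ ∈ admissible P φ) : nextState P φ θ ≤ φ := by
  rw [h.nextState_eq]
  exact mul_le_of_le_one_right hφ (by linarith [(h.success_mem hθ.1 hθ.2.1).1])

theorem Params.Valid.nextState_mono (h : P.Valid) {x y θ : ℝ} (hyx : y ≤ x)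
    (h₀ : 0 ≤ θ) (h₁ : θ ≤ P.σ) : nextState P y θ ≤ nextState P x θ := by
  rw [h.nextState_eq, h.nextState_eq]
  have := (h.success_mem h₀ h₁).2
  exact mul_le_mul_of_nonneg_right hyx (by linarith [h.add_le_one, h.τ_pos, h.σ_pos])

theorem Params.Valid.nextState_mem (h : P.Valid) {φ θ : ℝ} (hφ : φ ∈ Icc (0 : ℝ) 1)
    (hθ : θ ∈ admissible P φ) : nextState P φ θ ∈ Icc (0 : ℝ) 1 :=
  ⟨h.nextState_nonneg hφ.1 hθ, (h.nextState_le hφ.1 hθ).trans hφ.2⟩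

/-- A threshold stays admissible when the disadvantaged group shrinks. -/
theorem Params.Valid.admissible_of_le (h : P.Valid) {x y θ : ℝ} (hyx : y ≤ x)
    (hθ : θ ∈ admissible P x) : θ ∈ admissible P y := by
  obtain ⟨h₀, h₁, h₂, h₃⟩ := hθ
  have hf₀ : 0 ≤ 1 - θ / P.σ := sub_nonneg.2 ((div_le_one h.σ_pos).2 h₁)
  have hf₁ : 1 - θ / P.σ ≤ 1 := sub_le_self _ (div_nonneg h₀ h.σ_pos.le)
  refine ⟨h₀, h₁, ?_, ?_⟩ <;> nlinarith [h.α_le_one]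

theorem Params.Valid.commonThreshold_pos (h : P.Valid) {φ : ℝ} (hφ : φ < 1) :
    0 < commonThreshold P φ :=
  add_pos_of_nonneg_of_pos (mul_nonneg h.σ_pos.le (by linarith [h.α_le_one]))
    (mul_pos (by linarith) h.τ_pos)

theorem mem_matching_iff {φ : ℝ} (hφ : φ ≠ 1) (θ₀ θ₁ : ℝ) :
    θ₁ ∈ matching P φ θ₀ ↔ θ₁ = (commonThreshold P φ - φ * θ₀) / (1 - φ) := by
  simp [matching, hφ, commonThreshold]

theorem Params.Valid.exists_abs_reward_le (h : P.Valid) :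
    ∃ M, ∀ φ ∈ Icc (0 : ℝ) 1, ∀ θ ∈ admissible P φ, |reward P φ θ| ≤ M := by
  have hσ := h.σ_pos
  have hτ := h.τ_pos
  refine ⟨P.σ / 2 + (P.σ + P.τ) ^ 2 / (2 * P.σ), fun φ hφ θ hθ => ?_⟩
  have hs := h.success_mem hθ.1 hθ.2.1
  rw [reward]
  split_ifs with hφ₁
  · have : 0 ≤ (P.σ + P.τ) ^ 2 / (2 * P.σ) := by positivity
    rw [one_div_mul_eq_div, abs_of_nonneg hs.1]
    linarith
  · have hw : 0 < 1 - φ := sub_pos.2 (lt_of_le_of_ne hφ.2 hφ₁)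
    obtain ⟨-, -, h₂, h₃⟩ := hθ
    set θ₁ := (P.σ * (1 - P.α) + (1 - φ) * P.τ - φ * θ) / (1 - φ) with hθ₁
    have e : P.σ * (φ * (1 - θ / P.σ)) = φ * P.σ - φ * θ := by field_simp
    have hlo : P.τ ≤ θ₁ := by
      rw [hθ₁, le_div_iff₀ hw]
      nlinarith [mul_le_mul_of_nonneg_left h₃ hσ.le]
    have hhi : θ₁ ≤ P.σ + P.τ := by
      rw [hθ₁, div_le_iff₀ hw]
      nlinarith [mul_le_mul_of_nonneg_left h₂ hσ.le]
    have hA : 0 ≤ ((P.σ + P.τ) ^ 2 - θ₁ ^ 2) / (2 * P.σ) :=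
      div_nonneg (by nlinarith) (by positivity)
    have hA' : ((P.σ + P.τ) ^ 2 - θ₁ ^ 2) / (2 * P.σ) ≤ (P.σ + P.τ) ^ 2 / (2 * P.σ) := by
      gcongr
      nlinarith [sq_nonneg θ₁]
    rw [div_mul_eq_mul_div, div_mul_eq_mul_div, mul_div_assoc, mul_div_assoc, abs_of_nonneg
      (add_nonneg (mul_nonneg hφ.1 hs.1) (mul_nonneg hw.le hA))]
    nlinarith [hφ.1, hφ.2]

/-! ### Existence of the value function -/

/-- The action is reparametrized by the mass `d = φ * (1 - θ / σ)` of selected members of `D`. It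
ranges over the interval from `max 0 (α - 1 + φ)` to `min φ α`, whose ends are continuous in `φ`,
whereas the admissible thresholds may jump at `φ = 0`. Clamping `[0, 1]` to that
interval makes the action space independent of the state. -/
theorem Params.Valid.exists_isBellman (h : P.Valid) : ∃ V, IsBellman P V := by
  have hσ := h.σ_pos
  have hα₀ := h.α_nonneg
  have hα₁ := h.α_le_one
  let d : unitInterval × unitInterval → ℝ :=
    fun p => max (max 0 (P.α - 1 + p.1)) (min (p.2 : ℝ) (min p.1 P.α))
  have hd : Continuous d := by fun_prop
  have hd₀ : ∀ p, 0 ≤ d p := fun p => le_max_of_le_left (le_max_left _ _)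
  have hdφ : ∀ p, d p ≤ p.1 := fun p =>
    max_le (max_le p.1.2.1 (by linarith)) ((min_le_right _ _).trans (min_le_left _ _))
  have hdα : ∀ p, d p ≤ P.α := fun p =>
    max_le (max_le hα₀ (by linarith [p.1.2.2])) ((min_le_right _ _).trans (min_le_right _ _))
  have hdA : ∀ p, P.α - d p ≤ 1 - p.1 := fun p => by
    have : P.α - 1 + p.1 ≤ d p := le_max_of_le_left (le_max_right _ _)
    linarith
  have hqD : Continuous fun p : unitInterval × unitInterval => d p ^ 2 / (p.1 : ℝ) :=
    continuous_sq_div hd (by fun_prop) hd₀ hdφ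
  have hqA : Continuous fun p : unitInterval × unitInterval =>
      (P.α - d p) ^ 2 / (1 - (p.1 : ℝ)) :=
    continuous_sq_div (by fun_prop) (by fun_prop) (fun p => sub_nonneg.2 (hdα p)) hdA
  let ρ : unitInterval × unitInterval → ℝ := fun p => (P.σ + P.τ) * P.α - P.τ * d p
    - P.σ / 2 * (d p ^ 2 / (p.1 : ℝ)) - P.σ / 2 * ((P.α - d p) ^ 2 / (1 - (p.1 : ℝ)))
  let ν : unitInterval × unitInterval → ℝ := fun p =>
    p.1 - P.σ * d p + P.σ / 2 * (d p ^ 2 / (p.1 : ℝ))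
  have hρ : Continuous ρ := by fun_prop
  have hν : Continuous ν := by fun_prop
  obtain ⟨V, hV⟩ := exists_isGreatest_bellman h.γ_pos.le h.γ_lt_one
    (r := fun x s => ρ (x, s)) (n := fun x s => projIcc 0 1 zero_le_one (ν (x, s)))
    hρ (continuous_projIcc.comp hν)
  have hset : ∀ (φ : ℝ) (hφ : φ ∈ Icc (0 : ℝ) 1),
      (fun θ => reward P φ θ + P.γ * V (projIcc 0 1 zero_le_one (nextState P φ θ)))
          '' admissible P φ =
        range fun s => ρ (⟨φ, hφ⟩, s) + P.γ * V (projIcc 0 1 zero_le_one (ν (⟨φ, hφ⟩, s))) := by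
    intro φ hφ
    have hmatch : ∀ θ ∈ admissible P φ, ∀ s, d (⟨φ, hφ⟩, s) = φ * (1 - θ / P.σ) →
        ρ (⟨φ, hφ⟩, s) + P.γ * V (projIcc 0 1 zero_le_one (ν (⟨φ, hφ⟩, s))) =
        reward P φ θ + P.γ * V (projIcc 0 1 zero_le_one (nextState P φ θ)) := by
      intro θ hθ s hs
      have hDq : d (⟨φ, hφ⟩, s) ^ 2 / φ = φ * (1 - θ / P.σ) ^ 2 := by
        rw [hs]
        rcases eq_or_ne φ 0 with rfl | h0
        · simp
        · field_simp
      have e₁ : ρ (⟨φ, hφ⟩, s) = reward P φ θ := by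
        change (P.σ + P.τ) * P.α - P.τ * d (⟨φ, hφ⟩, s) - P.σ / 2 * (d (⟨φ, hφ⟩, s) ^ 2 / φ)
          - P.σ / 2 * ((P.α - d (⟨φ, hφ⟩, s)) ^ 2 / (1 - φ)) = _
        rw [hDq, hs]
        rcases eq_or_ne φ 1 with rfl | h1
        · have hf : P.α = 1 - θ / P.σ := by linarith [hθ.2.2.1, hθ.2.2.2]
          have hθ' : θ = P.σ * (1 - P.α) := by rw [hf]; field_simp; ring
          rw [← hf, reward, if_pos rfl, hθ']
          field_simp
          ring
        · have h1' : 1 - φ ≠ 0 := sub_ne_zero.2 h1.symm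
          rw [reward, if_neg h1]
          field_simp
          ring
      have e₂ : ν (⟨φ, hφ⟩, s) = nextState P φ θ := by
        change φ - P.σ * d (⟨φ, hφ⟩, s) + P.σ / 2 * (d (⟨φ, hφ⟩, s) ^ 2 / φ) = _
        rw [hDq, hs, h.nextState_eq]
        field_simp
        ring
      rw [e₁, e₂]
    ext v
    constructor
    · rintro ⟨θ, hθ, rfl⟩
      have hf₀ : 0 ≤ 1 - θ / P.σ := sub_nonneg.2 ((div_le_one hσ).2 hθ.2.1)
      have hf₁ : 1 - θ / P.σ ≤ 1 := sub_le_self _ (div_nonneg hθ.1 hσ.le)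
      have hm₀ : 0 ≤ φ * (1 - θ / P.σ) := mul_nonneg hφ.1 hf₀
      have hmφ : φ * (1 - θ / P.σ) ≤ φ := mul_le_of_le_one_right hφ.1 hf₁
      refine ⟨⟨φ * (1 - θ / P.σ), hm₀, hmφ.trans hφ.2⟩, hmatch θ hθ _ ?_⟩
      change max (max 0 (P.α - 1 + φ)) (min (φ * (1 - θ / P.σ)) (min φ P.α)) = _
      rw [min_eq_left (le_min hmφ hθ.2.2.1),
        max_eq_right (max_le hm₀ (by linarith [hθ.2.2.2]))]
    · rintro ⟨s, rfl⟩
      have a₀ := hd₀ (⟨φ, hφ⟩, s)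
      have a₁ : d (⟨φ, hφ⟩, s) ≤ φ := hdφ (⟨φ, hφ⟩, s)
      have a₂ := hdα (⟨φ, hφ⟩, s)
      have a₃ : P.α - d (⟨φ, hφ⟩, s) ≤ 1 - φ := hdA (⟨φ, hφ⟩, s)
      have e : d (⟨φ, hφ⟩, s) = φ * (1 - P.σ * (1 - d (⟨φ, hφ⟩, s) / φ) / P.σ) := by
        rcases eq_or_ne φ 0 with h0 | h0
        · have hd0 : d (⟨φ, hφ⟩, s) = 0 := by linarith
          rw [hd0]
          simp [h0]
        · field_simp
          ring
      have b₀ : 0 ≤ d (⟨φ, hφ⟩, s) / φ := div_nonneg a₀ hφ.1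
      have b₁ : d (⟨φ, hφ⟩, s) / φ ≤ 1 := div_le_one_of_le₀ a₁ hφ.1
      have hθ : P.σ * (1 - d (⟨φ, hφ⟩, s) / φ) ∈ admissible P φ := by
        refine ⟨mul_nonneg hσ.le (by linarith), mul_le_of_le_one_right hσ.le (by linarith),
          ?_, ?_⟩
        · rw [← e]; exact a₂
        · rw [← e]; linarith
      exact ⟨_, hθ, (hmatch _ hθ s e).symm⟩
  refine ⟨fun φ => V (projIcc 0 1 zero_le_one φ), ?_, fun φ hφ => ?_⟩
  · exact ⟨‖V‖, fun φ _ => V.norm_coe_le_norm _⟩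
  · rw [hset φ hφ, projIcc_of_mem zero_le_one hφ]
    exact hV ⟨φ, hφ⟩

/-! ### Policies and the Bellman equation -/

theorem IsBellman.exists_isGreedy {V : ℝ → ℝ} (hV : IsBellman P V) {φ : ℝ}
    (hφ : φ ∈ Icc (0 : ℝ) 1) : ∃ θ, IsGreedy P V φ θ :=
  (hV.isGreatest φ hφ).1

theorem IsBellman.le {V : ℝ → ℝ} (hV : IsBellman P V) {φ θ : ℝ}
    (hφ : φ ∈ Icc (0 : ℝ) 1) (hθ : θ ∈ admissible P φ) :
    reward P φ θ + P.γ * V (nextState P φ θ) ≤ V φ :=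
  (hV.isGreatest φ hφ).2 ⟨θ, hθ, rfl⟩

theorem trajectory_succ' (π : ℝ → ℝ) (φ : ℝ) (t : ℕ) :
    trajectory P π φ (t + 1) = trajectory P π (nextState P φ (π φ)) t := by
  induction t with
  | zero => rfl
  | succ t ih => rw [trajectory, ih, trajectory]

theorem Params.Valid.trajectory_mem (h : P.Valid) {π : ℝ → ℝ} (hπ : IsPolicy P π) {φ : ℝ}
    (hφ : φ ∈ Icc (0 : ℝ) 1) (t : ℕ) : trajectory P π φ t ∈ Icc (0 : ℝ) 1 := by
  induction t with
  | zero => exact hφ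
  | succ t ih => exact h.nextState_mem ih (hπ _ ih)

theorem Params.Valid.norm_discounted_reward_le (h : P.Valid) {M : ℝ}
    (hM : ∀ φ ∈ Icc (0 : ℝ) 1, ∀ θ ∈ admissible P φ, |reward P φ θ| ≤ M) {π : ℝ → ℝ}
    (hπ : IsPolicy P π) {φ : ℝ} (hφ : φ ∈ Icc (0 : ℝ) 1) (t : ℕ) :
    ‖P.γ ^ t * reward P (trajectory P π φ t) (π (trajectory P π φ t))‖ ≤ P.γ ^ t * M := by
  have hγ := pow_nonneg h.γ_pos.le t
  rw [norm_mul, Real.norm_of_nonneg hγ]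
  exact mul_le_mul_of_nonneg_left
    (hM _ (h.trajectory_mem hπ hφ t) _ (hπ _ (h.trajectory_mem hπ hφ t))) hγ

theorem Params.Valid.exists_abs_policyValue_le (h : P.Valid) :
    ∃ M, ∀ π, IsPolicy P π → ∀ φ ∈ Icc (0 : ℝ) 1, |policyValue P π φ| ≤ M := by
  obtain ⟨M, hM⟩ := h.exists_abs_reward_le
  exact ⟨(1 - P.γ)⁻¹ * M, fun π hπ φ hφ => tsum_of_norm_bounded
    ((hasSum_geometric_of_lt_one h.γ_pos.le h.γ_lt_one).mul_right M)
    (h.norm_discounted_reward_le hM hπ hφ)⟩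

theorem Params.Valid.policyValue_eq (h : P.Valid) {π : ℝ → ℝ} (hπ : IsPolicy P π) {φ : ℝ}
    (hφ : φ ∈ Icc (0 : ℝ) 1) :
    policyValue P π φ =
      reward P φ (π φ) + P.γ * policyValue P π (nextState P φ (π φ)) := by
  obtain ⟨M, hM⟩ := h.exists_abs_reward_le
  have hs : Summable fun t : ℕ =>
      P.γ ^ t * reward P (trajectory P π φ t) (π (trajectory P π φ t)) :=
    Summable.of_norm_bounded
      ((summable_geometric_of_lt_one h.γ_pos.le h.γ_lt_one).mul_right M)
      (h.norm_discounted_reward_le hM hπ hφ)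
  rw [policyValue, hs.tsum_eq_zero_add, policyValue, ← tsum_mul_left]
  congr 1
  · rw [pow_zero, one_mul, trajectory]
  · refine tsum_congr fun t => ?_
    rw [trajectory_succ', pow_succ']
    ring

theorem IsOptimal.isBellman (h : P.Valid) {π : ℝ → ℝ} (hπ : IsOptimal P π) :
    IsBellman P (policyValue P π) where
  bounded := by
    obtain ⟨M, hM⟩ := h.exists_abs_policyValue_le
    exact ⟨M, hM π hπ.1⟩
  isGreatest := hπ.2

theorem IsOptimal.isGreedy (h : P.Valid) {π : ℝ → ℝ} (hπ : IsOptimal P π) {φ : ℝ}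
    (hφ : φ ∈ Icc (0 : ℝ) 1) : IsGreedy P (policyValue P π) φ (π φ) :=
  ⟨hπ.1 φ hφ, (h.policyValue_eq hπ.1 hφ).symm⟩

/-- Every greedy threshold of a Bellman solution is played by an optimal policy: any greedy
policy has that solution as its value function. -/
theorem IsBellman.exists_isOptimal (h : P.Valid) {V : ℝ → ℝ} (hV : IsBellman P V) {φ₀ θ₀ : ℝ}
    (hθ₀ : IsGreedy P V φ₀ θ₀) : ∃ π, IsOptimal P π ∧ π φ₀ = θ₀ := by
  classical
  choose! g hg using fun (φ : ℝ) (hφ : φ ∈ Icc (0 : ℝ) 1) => hV.exists_isGreedy hφ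
  let π := Function.update g φ₀ θ₀
  have hπ₀ : π φ₀ = θ₀ := Function.update_self ..
  have hπg : ∀ φ ∈ Icc (0 : ℝ) 1, IsGreedy P V φ (π φ) := by
    intro φ hφ
    rcases eq_or_ne φ φ₀ with rfl | hne
    · rwa [hπ₀]
    · rw [show π φ = g φ from Function.update_of_ne hne ..]
      exact hg φ hφ
  have hπ : IsPolicy P π := fun φ hφ => (hπg φ hφ).1
  obtain ⟨M, hM⟩ := h.exists_abs_policyValue_le
  obtain ⟨M', hM'⟩ := hV.bounded
  have hdist : ∀ φ ∈ Icc (0 : ℝ) 1, |policyValue P π φ - V φ| ≤ 0 := by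
    refine nonpos_of_le_discounted (M := M + M') h.γ_pos.le h.γ_lt_one
      (fun φ hφ => (abs_sub _ _).trans (add_le_add (hM π hπ φ hφ) (hM' φ hφ))) fun φ hφ => ?_
    refine ⟨_, h.nextState_mem hφ (hπ φ hφ), ?_⟩
    rw [h.policyValue_eq hπ hφ, ← (hπg φ hφ).2, add_sub_add_left_eq_sub, ← mul_sub, abs_mul,
      abs_of_pos h.γ_pos]
  have heq : ∀ φ ∈ Icc (0 : ℝ) 1, policyValue P π φ = V φ := fun φ hφ =>
    sub_eq_zero.1 (abs_nonpos_iff.1 (hdist φ hφ))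
  refine ⟨π, ⟨hπ, fun φ hφ => ?_⟩, hπ₀⟩
  have himg : (fun θ => reward P φ θ + P.γ * policyValue P π (nextState P φ θ)) ''
      admissible P φ = (fun θ => reward P φ θ + P.γ * V (nextState P φ θ)) '' admissible P φ :=
    image_congr fun θ hθ => by rw [heq _ (h.nextState_mem hφ hθ)]
  rw [himg, heq φ hφ]
  exact hV.isGreatest φ hφ

/-! ### The value of a smaller disadvantaged group -/

/-- The threshold chosen at `x` is admissible at `y ≤ x`, earns at least as much there, and keeps
the two states in order. -/
theorem IsBellman.antitone (h : P.Valid) {V : ℝ → ℝ} (hV : IsBellman P V) {x y : ℝ}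
    (hy : 0 ≤ y) (hyx : y ≤ x) (hx : x < 1) : V x ≤ V y := by
  obtain ⟨M, hM⟩ := hV.bounded
  have key := nonpos_of_le_discounted (S := {p : ℝ × ℝ | 0 ≤ p.2 ∧ p.2 ≤ p.1 ∧ p.1 < 1})
    (D := fun p => V p.1 - V p.2) (M := M + M) h.γ_pos.le h.γ_lt_one ?_ ?_ (x, y) ⟨hy, hyx, hx⟩
  · exact sub_nonpos.1 key
  · rintro ⟨x, y⟩ ⟨hy, hyx, hx⟩
    dsimp only at hy hyx hx ⊢
    have h₁ := abs_le.1 (hM x ⟨hy.trans hyx, hx.le⟩)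
    have h₂ := abs_le.1 (hM y ⟨hy, (hyx.trans_lt hx).le⟩)
    linarith [h₁.2, h₂.1]
  · rintro ⟨x, y⟩ ⟨hy, hyx, hx⟩
    dsimp only at hy hyx hx ⊢
    have hxI : x ∈ Icc (0 : ℝ) 1 := ⟨hy.trans hyx, hx.le⟩
    have hyI : y ∈ Icc (0 : ℝ) 1 := ⟨hy, (hyx.trans_lt hx).le⟩
    obtain ⟨θ, hθ, hgx⟩ := hV.exists_isGreedy hxI
    have hθy := h.admissible_of_le hyx hθ
    have hgy := hV.le hyI hθy
    refine ⟨(nextState P x θ, nextState P y θ), ⟨h.nextState_nonneg hy hθy,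
      h.nextState_mono hyx hθ.1 hθ.2.1, (h.nextState_le hxI.1 hθ).trans_lt hx⟩, ?_⟩
    · have hr := reward_sub_reward h.σ_pos.ne' hx.ne (hyx.trans_lt hx).ne θ
      have hf : 0 ≤ 1 - θ / P.σ := sub_nonneg.2 ((div_le_one h.σ_pos).2 hθ.2.1)
      have h₁ : 0 < 1 - x := sub_pos.2 hx
      have h₂ : 0 < 1 - y := by linarith
      have h₃ := h.τ_pos
      have h₄ := h.σ_pos
      have : 0 ≤ reward P y θ - reward P x θ := by
        rw [hr]
        exact mul_nonneg (sub_nonneg.2 hyx) (by positivity)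
      dsimp only
      linarith

/-- This lower bound for the bracket in `reward_sub_reward` is itself bounded away
from `0`: either `f ≥ α / 2` or `(α - f) ^ 2 ≥ (α / 2) ^ 2`. -/
theorem Params.Valid.exists_rate (h : P.Valid) (hα : 0 < P.α) :
    ∃ c, 0 < c ∧ ∀ f, 0 ≤ f → c ≤ P.τ * f + P.σ * (P.α - f) ^ 2 / 2 := by
  have hτ := h.τ_pos
  have hσ := h.σ_pos
  refine ⟨min (P.τ * (P.α / 2)) (P.σ * (P.α / 2) ^ 2 / 2), lt_min (by positivity) (by positivity),
    fun f hf => ?_⟩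
  rcases le_total (P.α / 2) f with hc | hc
  · refine (min_le_left _ _).trans ?_
    have : 0 ≤ P.σ * (P.α - f) ^ 2 / 2 := by positivity
    linarith [mul_le_mul_of_nonneg_left hc hτ.le]
  · refine (min_le_right _ _).trans ?_
    have h₁ : (P.α / 2) ^ 2 ≤ (P.α - f) ^ 2 := pow_le_pow_left₀ (by positivity) (by linarith) 2
    have : 0 ≤ P.τ * f := by positivity
    linarith [mul_le_mul_of_nonneg_left h₁ hσ.le]

/-- The value decreases at least linearly in the fraction of disadvantaged agents. -/
theorem IsBellman.exists_decrease_rate (h : P.Valid) (hα : 0 < P.α) {V : ℝ → ℝ}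
    (hV : IsBellman P V) :
    ∃ c, 0 < c ∧ ∀ x y, 0 ≤ y → y ≤ x → x < 1 → c * (x - y) ≤ V y - V x := by
  obtain ⟨c, hc, hcf⟩ := h.exists_rate hα
  refine ⟨c, hc, fun x y hy hyx hx => ?_⟩
  have hxI : x ∈ Icc (0 : ℝ) 1 := ⟨hy.trans hyx, hx.le⟩
  obtain ⟨θ, hθ, hgx⟩ := hV.exists_isGreedy hxI
  have hθy := h.admissible_of_le hyx hθ
  have hgy := hV.le ⟨hy, (hyx.trans_lt hx).le⟩ hθy
  have hnext : V (nextState P x θ) ≤ V (nextState P y θ) :=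
    hV.antitone h (h.nextState_nonneg hy hθy) (h.nextState_mono hyx hθ.1 hθ.2.1)
      ((h.nextState_le hxI.1 hθ).trans_lt hx)
  have hr := reward_sub_reward h.σ_pos.ne' hx.ne (hyx.trans_lt hx).ne θ
  have hf : 0 ≤ 1 - θ / P.σ := sub_nonneg.2 ((div_le_one h.σ_pos).2 hθ.2.1)
  have h₁ : 0 < 1 - x := sub_pos.2 hx
  have h₂ : 0 < 1 - y := by linarith
  have h₃ := h.σ_pos
  have hquot : P.σ * (P.α - (1 - θ / P.σ)) ^ 2 / 2 ≤
      P.σ * (P.α - (1 - θ / P.σ)) ^ 2 / (2 * (1 - x) * (1 - y)) := by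
    apply div_le_div_of_nonneg_left (by positivity) (by positivity)
    nlinarith [hxI.1]
  have hrate : c * (x - y) ≤ reward P y θ - reward P x θ := by
    rw [hr, mul_comm c]
    exact mul_le_mul_of_nonneg_left (by linarith [hcf _ hf]) (sub_nonneg.2 hyx)
  linarith [mul_le_mul_of_nonneg_left hnext h.γ_pos.le]

/-- A greedy threshold gives `D` strictly more than the myopic optimum: moving from a threshold at
or above the vertex `t` to `t - δ` costs `O(δ ^ 2)` now and gains a multiple of `δ` later. -/
theorem IsGreedy.lt_commonThreshold (h : P.Valid) (hα : 0 < P.α) {V : ℝ → ℝ}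
    (hV : IsBellman P V) {φ θ : ℝ} (hφ₀ : 0 < φ) (hφ₁ : φ < 1) (hθ : IsGreedy P V φ θ) :
    θ < commonThreshold P φ := by
  by_contra! hle
  obtain ⟨c, hc, hdec⟩ := hV.exists_decrease_rate h hα
  have ht := h.commonThreshold_pos hφ₁
  have hσ := h.σ_pos
  have hτ := h.τ_pos
  have hγ := h.γ_pos
  have hw : 0 < 1 - φ := sub_pos.2 hφ₁
  have htdef : commonThreshold P φ = P.σ * (1 - P.α) + (1 - φ) * P.τ := rfl
  set t := commonThreshold P φ
  obtain ⟨δ, hδ₀, hδt, hδτ, hδc⟩ : ∃ δ, 0 < δ ∧ δ ≤ t ∧ δ ≤ (1 - φ) * P.τ ∧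
      δ ≤ P.γ * c * t * (1 - φ) / 2 :=
    ⟨min t (min ((1 - φ) * P.τ) (P.γ * c * t * (1 - φ) / 2)), by positivity, min_le_left _ _,
      (min_le_right _ _).trans (min_le_left _ _), (min_le_right _ _).trans (min_le_right _ _)⟩
  obtain ⟨⟨hθ₀, hθσ, hθD, hθA⟩, hval⟩ := hθ
  have hφI : φ ∈ Icc (0 : ℝ) 1 := ⟨hφ₀.le, hφ₁.le⟩
  have hadm : t - δ ∈ admissible P φ := by
    refine ⟨by linarith, by linarith, ?_, hθA.trans ?_⟩
    · have e : φ * (1 - (t - δ) / P.σ) = φ * (P.σ - (t - δ)) / P.σ := by field_simp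
      rw [e, div_le_iff₀ hσ]
      have h₁ : P.σ - (t - δ) ≤ P.α * P.σ := by rw [htdef]; linarith
      have h₂ : 0 ≤ P.α * P.σ := by positivity
      nlinarith
    · gcongr
      linarith
  have hle' := hV.le hφI hadm
  have hr : reward P φ θ - reward P φ (t - δ) ≤ φ * δ ^ 2 / (2 * P.σ * (1 - φ)) := by
    rw [reward_eq_sub_sq hσ.ne' hφ₁.ne, reward_eq_sub_sq hσ.ne' hφ₁.ne]
    have h₁ : 0 ≤ φ * (θ - t) ^ 2 / (2 * P.σ * (1 - φ)) := by positivity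
    have h₂ : t - δ - t = -δ := by ring
    change _ - φ * (θ - t) ^ 2 / _ - (_ - φ * (t - δ - t) ^ 2 / _) ≤ _
    rw [h₂, neg_sq]
    linarith
  have hn : φ / (2 * P.σ) * (t * δ) ≤ nextState P φ θ - nextState P φ (t - δ) := by
    rw [nextState_of_eq P h.pA_eq_pD, nextState_of_eq P h.pA_eq_pD]
    have h₁ : t * δ ≤ θ ^ 2 - (t - δ) ^ 2 := by nlinarith
    have h₂ := mul_le_mul_of_nonneg_left h₁ (show 0 ≤ φ / (2 * P.σ) by positivity)
    linarith
  have hgain := hdec (nextState P φ θ) (nextState P φ (t - δ)) (h.nextState_nonneg hφ₀.le hadm)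
    (sub_nonneg.1 (le_trans (by positivity) hn))
    ((h.nextState_le hφ₀.le ⟨hθ₀, hθσ, hθD, hθA⟩).trans_lt hφ₁)
  have h₁ : P.γ * (c * (φ / (2 * P.σ) * (t * δ))) ≤ φ * δ ^ 2 / (2 * P.σ * (1 - φ)) :=
    calc _ ≤ P.γ * (c * (nextState P φ θ - nextState P φ (t - δ))) := by gcongr
      _ ≤ P.γ * (V (nextState P φ (t - δ)) - V (nextState P φ θ)) := by gcongr
      _ ≤ _ := by linarith
  have h₂ : φ * δ ^ 2 / (2 * P.σ * (1 - φ)) = φ / (2 * P.σ) * δ * (δ / (1 - φ)) := by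
    field_simp
  have h₃ : δ / (1 - φ) ≤ P.γ * c * t / 2 := by
    rw [div_le_iff₀ hw]
    linarith
  have h₄ : φ / (2 * P.σ) * δ * (δ / (1 - φ)) ≤ φ / (2 * P.σ) * δ * (P.γ * c * t / 2) := by
    gcongr
  have h₅ : 0 < φ / (2 * P.σ) * δ * (P.γ * c * t) := by positivity
  linarith

/-! ### Never selecting from the disadvantaged group -/

/-- The value of using the threshold `σ` forever. The state does not move, as nobody is selected
from `D`. -/
def stayValue (P : Params) (φ : ℝ) : ℝ := reward P φ P.σ / (1 - P.γ)

/-- The loss per selected agent of `D` from selecting a fraction `f` of `D` once and nobody from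
`D` later, instead of never selecting from `D`. -/
def deviationLoss (P : Params) (φ f : ℝ) : ℝ :=
  P.τ - P.σ * (2 * P.α - f) / (2 * (1 - φ)) - P.γ * P.σ ^ 2 * P.α ^ 2 * (1 - f / 2) /
    (2 * (1 - P.γ) * (1 - φ) * (1 - φ + φ * P.σ * (f - f ^ 2 / 2)))

theorem Params.Valid.nextState_σ (h : P.Valid) (φ : ℝ) : nextState P φ P.σ = φ := by
  rw [h.nextState_eq]
  simp

theorem Params.Valid.stayValue_sub (h : P.Valid) {φ θ : ℝ} (hφ₀ : 0 ≤ φ) (hφ₁ : φ < 1)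
    (hθ : θ ∈ admissible P φ) :
    stayValue P φ - (reward P φ θ + P.γ * stayValue P (nextState P φ θ)) =
      φ * (1 - θ / P.σ) * deviationLoss P φ (1 - θ / P.σ) := by
  have hσ := h.σ_pos.ne'
  have hn : nextState P φ θ < 1 := (h.nextState_le hφ₀ hθ).trans_lt hφ₁
  have hw : 1 - φ ≠ 0 := (sub_pos.2 hφ₁).ne'
  have hγ : 1 - P.γ ≠ 0 := (sub_pos.2 h.γ_lt_one).ne'
  have e : nextState P φ θ =
      φ - φ * P.σ * ((1 - θ / P.σ) - (1 - θ / P.σ) ^ 2 / 2) := by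
    rw [h.nextState_eq]
    field_simp
    ring
  have hw' : 1 - φ + φ * P.σ * ((1 - θ / P.σ) - (1 - θ / P.σ) ^ 2 / 2) ≠ 0 := by
    have := sub_pos.2 hn
    rw [e] at this
    linarith
  rw [stayValue, stayValue, reward_eq hσ hφ₁.ne, reward_eq hσ hφ₁.ne, reward_eq hσ hn.ne, e,
    deviationLoss, div_self hσ, sub_self, sub_sub_eq_add_sub 1 φ, add_sub_right_comm]
  generalize 1 - θ / P.σ = f at *
  -- The next fraction of `A` is kept as an atom so that it can be cleared from denominators.
  obtain ⟨w', hdef⟩ : ∃ w', w' = 1 - φ + φ * P.σ * (f - f ^ 2 / 2) := ⟨_, rfl⟩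
  rw [← hdef] at hw' ⊢
  field_simp
  rw [hdef]
  ring

/-- The loss per selected agent is smallest for infinitesimal deviations. -/
theorem Params.Valid.deviationLoss_zero_le (h : P.Valid) {φ f : ℝ} (hφ₀ : 0 ≤ φ) (hφ₁ : φ < 1)
    (hf₀ : 0 ≤ f) (hf₁ : f ≤ 1) : deviationLoss P φ 0 ≤ deviationLoss P φ f := by
  have hσ := h.σ_pos
  have hγ := h.γ_pos
  have hw : 0 < 1 - φ := sub_pos.2 hφ₁
  have hγ' : 0 < 1 - P.γ := sub_pos.2 h.γ_lt_one
  have hm : 0 ≤ φ * P.σ * (f - f ^ 2 / 2) := mul_nonneg (by positivity) (by nlinarith)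
  have h₁ : P.σ * (2 * P.α - f) / (2 * (1 - φ)) ≤ P.σ * (2 * P.α - 0) / (2 * (1 - φ)) := by
    gcongr
  have h₂ : P.γ * P.σ ^ 2 * P.α ^ 2 * (1 - f / 2) /
        (2 * (1 - P.γ) * (1 - φ) * (1 - φ + φ * P.σ * (f - f ^ 2 / 2))) ≤
      P.γ * P.σ ^ 2 * P.α ^ 2 * (1 - 0 / 2) /
        (2 * (1 - P.γ) * (1 - φ) * (1 - φ + φ * P.σ * (0 - 0 ^ 2 / 2))) := by
    apply div_le_div₀
    · simp only [zero_div, sub_zero, mul_one]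
      positivity
    · gcongr
    · simp only [zero_pow two_ne_zero, zero_div, sub_zero, mul_zero, add_zero]
      positivity
    · gcongr _ * (_ + ?_)
      simpa using hm
  unfold deviationLoss
  linarith

theorem continuousAt_deviationLoss {φ : ℝ} (hφ : φ ≠ 1) (hγ : P.γ ≠ 1) :
    ContinuousAt (deviationLoss P φ) 0 := by
  have hw : 1 - φ ≠ 0 := sub_ne_zero.2 hφ.symm
  have hγ' : 1 - P.γ ≠ 0 := sub_ne_zero.2 hγ.symm
  unfold deviationLoss
  refine (by fun_prop : ContinuousAt _ _).sub (ContinuousAt.div (by fun_prop) (by fun_prop) ?_)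
  simp [hw, hγ']

/-- With `u = σ * α / (1 - φ)` the infinitesimal loss is `τ - u - γ / (1 - γ) * u ^ 2 / 2`, a
quadratic in `u` whose positive root gives the tipping point. -/
theorem Params.Valid.deviationLoss_zero_nonneg_iff (h : P.Valid) {φ : ℝ} (hφ : φ < 1) :
    0 ≤ deviationLoss P φ 0 ↔
      φ ≤ 1 - P.α * P.σ / (2 * P.τ) * (1 + Real.sqrt (1 + 2 * P.τ * P.γ / (1 - P.γ))) := by
  have hτ := h.τ_pos
  have hσ := h.σ_pos
  have hγ := h.γ_pos
  have hα := h.α_nonneg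
  have hw : 0 < 1 - φ := sub_pos.2 hφ
  have hγ' : 0 < 1 - P.γ := sub_pos.2 h.γ_lt_one
  have hg : 0 < P.γ / (1 - P.γ) := div_pos hγ hγ'
  have hs := Real.sq_sqrt (show 0 ≤ 1 + 2 * P.τ * P.γ / (1 - P.γ) by positivity)
  have hs₁ : 1 ≤ √(1 + 2 * P.τ * P.γ / (1 - P.γ)) :=
    Real.one_le_sqrt.2 (le_add_of_nonneg_right (by positivity))
  set s := √(1 + 2 * P.τ * P.γ / (1 - P.γ))
  set u := P.σ * P.α / (1 - φ) with hu
  have hu₀ : 0 ≤ u := by positivity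
  have hg' : P.γ / (1 - P.γ) = (s ^ 2 - 1) / (2 * P.τ) := by
    rw [hs]
    field_simp
    ring
  have hfac : deviationLoss P φ 0 =
      (2 * P.τ - u * (1 + s)) * ((2 * P.τ + u * (s - 1)) / (4 * P.τ)) := by
    have : deviationLoss P φ 0 = P.τ - u - P.γ / (1 - P.γ) * u ^ 2 / 2 := by
      rw [deviationLoss, hu]
      field_simp
      ring
    rw [this, hg']
    field_simp
    ring
  have hpos : 0 < (2 * P.τ + u * (s - 1)) / (4 * P.τ) :=
    div_pos (by nlinarith [mul_nonneg hu₀ (sub_nonneg.2 hs₁)]) (by positivity)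
  rw [hfac, mul_nonneg_iff_of_pos_right hpos, sub_nonneg, hu, div_mul_eq_mul_div, div_le_iff₀ hw,
    le_sub_comm, div_mul_eq_mul_div, div_le_iff₀ (by positivity), mul_comm P.σ, mul_comm (1 - φ)]

theorem Params.Valid.σ_mem_admissible_iff (h : P.Valid) {φ : ℝ} :
    P.σ ∈ admissible P φ ↔ φ ≤ 1 - P.α := by
  have hσ := h.σ_pos
  constructor
  · rintro ⟨-, -, -, hA⟩
    rw [div_self hσ.ne'] at hA
    linarith
  · intro hφ
    refine ⟨hσ.le, le_rfl, ?_, ?_⟩ <;> rw [div_self hσ.ne']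
    · linarith [h.α_nonneg]
    · linarith

theorem stayValue_eq (hγ : P.γ ≠ 1) (φ : ℝ) :
    reward P φ P.σ + P.γ * stayValue P φ = stayValue P φ := by
  have : 1 - P.γ ≠ 0 := sub_ne_zero.2 hγ.symm
  rw [stayValue]
  field_simp
  ring

theorem IsBellman.stayValue_le (h : P.Valid) {V : ℝ → ℝ} (hV : IsBellman P V) {φ : ℝ}
    (hφ₀ : 0 ≤ φ) (hφ : φ ≤ 1 - P.α) : stayValue P φ ≤ V φ := by
  have hle := hV.le ⟨hφ₀, hφ.trans (by linarith [h.α_nonneg])⟩ (h.σ_mem_admissible_iff.2 hφ)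
  rw [h.nextState_σ] at hle
  rw [stayValue, div_le_iff₀ (sub_pos.2 h.γ_lt_one)]
  linarith

/-- Up to the tipping point selecting nobody from `D` is optimal. States never increase, so the
one-step deviations below `φ` are the only ones to be compared. -/
theorem IsBellman.isGreedy_σ (h : P.Valid) {V : ℝ → ℝ} (hV : IsBellman P V) {φ : ℝ}
    (hφ₀ : 0 ≤ φ) (hφ₁ : φ < 1) (hφα : φ ≤ 1 - P.α) (hloss : 0 ≤ deviationLoss P φ 0) :
    IsGreedy P V φ P.σ := by
  have hle : ∀ x ∈ Icc 0 φ, V x - stayValue P x ≤ 0 := by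
    obtain ⟨M, hM⟩ := hV.bounded
    obtain ⟨M', hM'⟩ := h.exists_abs_reward_le
    have hγ : 0 < 1 - P.γ := sub_pos.2 h.γ_lt_one
    refine nonpos_of_le_discounted (M := M + M' / (1 - P.γ)) h.γ_pos.le h.γ_lt_one
      (fun x hx => ?_) fun x hx => ?_
    · have hxI : x ∈ Icc (0 : ℝ) 1 := ⟨hx.1, hx.2.trans hφ₁.le⟩
      have h₁ := (abs_le.1 (hM x hxI)).2
      have h₂ := (abs_le.1 (hM' x hxI P.σ (h.σ_mem_admissible_iff.2 (hx.2.trans hφα)))).1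
      have h₃ : -M' / (1 - P.γ) ≤ stayValue P x := div_le_div_of_nonneg_right h₂ hγ.le
      rw [neg_div] at h₃
      linarith
    · have hx₁ := hx.2.trans_lt hφ₁
      obtain ⟨θ, hθ, hval⟩ := hV.exists_isGreedy ⟨hx.1, hx₁.le⟩
      refine ⟨_, ⟨h.nextState_nonneg hx.1 hθ, (h.nextState_le hx.1 hθ).trans hx.2⟩, ?_⟩
      have hf₀ : 0 ≤ 1 - θ / P.σ := sub_nonneg.2 ((div_le_one h.σ_pos).2 hθ.2.1)
      have hf₁ : 1 - θ / P.σ ≤ 1 := sub_le_self _ (div_nonneg hθ.1 h.σ_pos.le)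
      have hx₀ : 0 ≤ deviationLoss P x 0 :=
        (h.deviationLoss_zero_nonneg_iff hx₁).2
          (hx.2.trans ((h.deviationLoss_zero_nonneg_iff hφ₁).1 hloss))
      have hnonneg : 0 ≤ x * (1 - θ / P.σ) * deviationLoss P x (1 - θ / P.σ) :=
        mul_nonneg (mul_nonneg hx.1 hf₀)
          (hx₀.trans (h.deviationLoss_zero_le hx.1 hx₁ hf₀ hf₁))
      rw [← h.stayValue_sub hx.1 hx₁ hθ] at hnonneg
      linarith
  have heq : V φ = stayValue P φ :=
    le_antisymm (sub_nonpos.1 (hle φ ⟨hφ₀, le_rfl⟩)) (hV.stayValue_le h hφ₀ hφα)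
  refine ⟨h.σ_mem_admissible_iff.2 hφα, ?_⟩
  rw [h.nextState_σ, heq, stayValue_eq h.γ_lt_one.ne]

/-- If selecting nobody from `D` is optimal, the value is that of staying, so no small deviation
followed by staying is profitable. -/
theorem IsGreedy.deviationLoss_nonneg (h : P.Valid) (hα : 0 < P.α) {V : ℝ → ℝ}
    (hV : IsBellman P V) {φ : ℝ} (hφ₀ : 0 < φ) (hφ₁ : φ < 1) (hθ : IsGreedy P V φ P.σ) :
    0 ≤ deviationLoss P φ 0 := by
  obtain ⟨hadm, hval⟩ := hθ
  have hφα := h.σ_mem_admissible_iff.1 hadm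
  have hσ := h.σ_pos
  have hstay : V φ = stayValue P φ := by
    rw [h.nextState_σ] at hval
    rw [stayValue, eq_div_iff (sub_pos.2 h.γ_lt_one).ne']
    linarith
  have hlim : Tendsto (deviationLoss P φ) (𝓝[>] 0) (𝓝 (deviationLoss P φ 0)) :=
    (continuousAt_deviationLoss hφ₁.ne h.γ_lt_one.ne).tendsto.mono_left nhdsWithin_le_nhds
  refine ge_of_tendsto hlim ?_
  filter_upwards [Ioo_mem_nhdsGT (lt_min hα one_pos)] with f hf
  have hf₀ := hf.1
  have hfα := hf.2.trans_le (min_le_left _ _)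
  have hf₁ := hf.2.trans_le (min_le_right _ _)
  have e : 1 - P.σ * (1 - f) / P.σ = f := by field_simp; ring
  have hθ : P.σ * (1 - f) ∈ admissible P φ := by
    refine ⟨mul_nonneg hσ.le (by linarith), mul_le_of_le_one_right hσ.le (by linarith), ?_, ?_⟩
      <;> rw [e] <;> nlinarith
  have hn := (h.nextState_le hφ₀.le hθ).trans hφα
  have h₁ := hV.le ⟨hφ₀.le, hφ₁.le⟩ hθ
  have h₂ := mul_le_mul_of_nonneg_left
    (hV.stayValue_le h (h.nextState_nonneg hφ₀.le hθ) hn) h.γ_pos.le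
  have h₃ := h.stayValue_sub hφ₀.le hφ₁ hθ
  rw [e] at h₃
  have h₄ : 0 ≤ φ * f * deviationLoss P φ f := by linarith
  exact nonneg_of_mul_nonneg_right h₄ (by positivity)

/-! ### Comparison of the thresholds -/

theorem Params.Valid.exists_equal_thresholds (h : P.Valid) {φ : ℝ} (hφ₀ : 0 ≤ φ)
    (hφ₁ : φ ≤ 1) (hφ : φ ≤ tippingPoint P) : ∃ θ, (θ, θ) ∈ optimalPairs P φ := by
  have hσ := h.σ_pos
  have hτ := h.τ_pos
  obtain ⟨V, hV⟩ := h.exists_isBellman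
  suffices ∃ θ, IsGreedy P V φ (min θ P.σ) ∧ θ ∈ matching P φ (min θ P.σ) by
    obtain ⟨θ, hg, hm⟩ := this
    exact ⟨θ, hV.exists_isOptimal h hg, hm⟩
  rcases hφ₁.eq_or_lt with rfl | hφ₁
  · -- The tipping point is `1` only for `α = 0`, and then `σ` is the only admissible threshold.
    refine ⟨P.σ + P.τ, ?_, ?_⟩
    · obtain ⟨θ, hθ⟩ := hV.exists_isGreedy ⟨zero_le_one, le_rfl⟩
      have hα : P.α = 0 := by
        have : (1 : ℝ) ≤ max 0 (1 - P.α) := hφ.trans (max_le_max_left 0 (min_le_left _ _))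
        have := (le_max_iff.1 this).resolve_left (by norm_num)
        linarith [h.α_nonneg]
      have : θ = P.σ := by
        have hf := hθ.1.2.2.1
        rw [hα, one_mul, sub_nonpos, one_le_div hσ] at hf
        exact le_antisymm hθ.1.2.1 hf
      rwa [min_eq_right (by linarith), ← this]
    · rw [matching, mem_ofPred_eq, if_pos rfl]
      exact ⟨by linarith, le_rfl⟩
  rcases hφ₀.eq_or_lt with rfl | hφ₀
  · -- Without disadvantaged agents every admissible threshold for `D` is optimal.
    refine ⟨commonThreshold P 0, ?_, by simp [mem_matching_iff]⟩
    have ht := (h.commonThreshold_pos zero_lt_one).le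
    have hadm : ∀ θ, 0 ≤ θ → θ ≤ P.σ → θ ∈ admissible P 0 := fun θ h₀ h₁ =>
      ⟨h₀, h₁, by simpa using h.α_nonneg, by simpa using h.α_le_one⟩
    obtain ⟨θ, hθ, hval⟩ := hV.exists_isGreedy ⟨le_rfl, zero_le_one⟩
    refine ⟨hadm _ (le_min ht hσ.le) (min_le_right _ _), ?_⟩
    rw [← hval, h.nextState_eq, h.nextState_eq]
    simp [reward]
  · have hcap := (le_max_iff.1 hφ).resolve_left hφ₀.not_ge
    have hφα := hcap.trans (min_le_left _ _)
    have hw : 0 < 1 - φ := sub_pos.2 hφ₁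
    have hloss := (h.deviationLoss_zero_nonneg_iff hφ₁).2 (hcap.trans (min_le_right _ _))
    have hge : P.σ ≤ (commonThreshold P φ - φ * P.σ) / (1 - φ) := by
      -- The static part of the deviation loss alone gives the bound.
      have hu : P.σ * P.α / (1 - φ) ≤ P.τ := by
        have hγ := h.γ_pos
        have hγ' : 0 < 1 - P.γ := sub_pos.2 h.γ_lt_one
        have e : deviationLoss P φ 0 = P.τ - P.σ * P.α / (1 - φ) - P.γ * P.σ ^ 2 * P.α ^ 2 /
            (2 * (1 - P.γ) * (1 - φ) * (1 - φ)) := by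
          rw [deviationLoss]
          field_simp
          ring
        have : 0 ≤ P.γ * P.σ ^ 2 * P.α ^ 2 / (2 * (1 - P.γ) * (1 - φ) * (1 - φ)) := by
          positivity
        linarith
      rw [div_le_iff₀ hw] at hu
      rw [le_div_iff₀ hw, commonThreshold]
      linarith
    refine ⟨(commonThreshold P φ - φ * P.σ) / (1 - φ), ?_, ?_⟩
    · rw [min_eq_right hge]
      exact hV.isGreedy_σ h hφ₀.le hφ₁ hφα hloss
    · rw [mem_matching_iff hφ₁.ne, min_eq_right hge]

theorem Params.Valid.α_pos_of_tippingPoint_lt_one (h : P.Valid) (ht : tippingPoint P < 1) :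
    0 < P.α := by
  refine h.α_nonneg.lt_of_ne fun hα => ht.ne ?_
  simp [tippingPoint, ← hα]

/-- The common threshold separates the two components, so that the thresholds of two different
optimal pairs can be compared as well. -/
theorem Params.Valid.lt_commonThreshold_of_mem_optimalPairs (h : P.Valid) {φ : ℝ}
    (hφ : tippingPoint P < φ) (hφ₁ : φ < 1) {θ : ℝ × ℝ} (hθ : θ ∈ optimalPairs P φ) :
    θ.1 < commonThreshold P φ ∧ commonThreshold P φ < θ.2 := by
  have hφ₀ : 0 < φ := (le_max_left _ _).trans_lt hφ
  have hα := h.α_pos_of_tippingPoint_lt_one (hφ.trans hφ₁)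
  have hw : 0 < 1 - φ := sub_pos.2 hφ₁
  obtain ⟨⟨π, hπ, hπφ⟩, hm⟩ := hθ
  have hg := hπ.isGreedy h ⟨hφ₀.le, hφ₁.le⟩
  rw [hπφ] at hg
  have hlt := hg.lt_commonThreshold h hα (hπ.isBellman h) hφ₀ hφ₁
  constructor
  · by_contra! hle
    -- The capped threshold is below the common one, so the cap at `σ` is in force.
    have hσt := (min_lt_iff.1 hlt).resolve_left hle.not_gt
    rw [min_eq_right (hσt.le.trans hle)] at hg
    have hloss := hg.deviationLoss_nonneg h hα (hπ.isBellman h) hφ₀ hφ₁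
    have hcap := (h.deviationLoss_zero_nonneg_iff hφ₁).1 hloss
    exact hφ.not_ge (le_max_of_le_right (le_min (h.σ_mem_admissible_iff.1 hg.1) hcap))
  · rw [mem_matching_iff hφ₁.ne] at hm
    rw [hm, lt_div_iff₀ hw]
    linarith [mul_lt_mul_of_pos_left hlt hφ₀]

end OpportunityAllocation

end

theorem theorem1 (P : OpportunityAllocation.Params)
    (hα₀ : 0 ≤ P.α) (hα₁ : P.α ≤ 1) (hσ : 0 < P.σ) (hτ : 0 < P.τ) (hστ : P.σ + P.τ ≤ 1)
    (hγ₀ : 0 < P.γ) (hγ₁ : P.γ < 1) (hp₀ : 0 ≤ P.pA) (hp₁ : P.pA ≤ 1) (hp : P.pA = P.pD) :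
    (∀ φ : ℝ, 0 ≤ φ → φ ≤ 1 → φ ≤ OpportunityAllocation.tippingPoint P →
      ∃ θ₀ ∈ OpportunityAllocation.optimalD P φ, ∃ θ₁ ∈ OpportunityAllocation.optimalA P φ,
        (θ₀, θ₁) ∈ OpportunityAllocation.optimalPairs P φ ∧ θ₀ = θ₁) ∧
    (∀ φ : ℝ, OpportunityAllocation.tippingPoint P < φ → φ < 1 →
      ∀ θ₀ ∈ OpportunityAllocation.optimalD P φ, ∀ θ₁ ∈ OpportunityAllocation.optimalA P φ,
        θ₀ < θ₁) ∧
    (OpportunityAllocation.tippingPoint P < 1 →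
      ∀ θ₀ ∈ OpportunityAllocation.optimalD P 1, ∃ θ₁ ∈ OpportunityAllocation.optimalA P 1,
        (θ₀, θ₁) ∈ OpportunityAllocation.optimalPairs P 1 ∧ θ₀ < θ₁) := by
  have h : OpportunityAllocation.Params.Valid P := ⟨hα₀, hα₁, hσ, hτ, hστ, hγ₀, hγ₁, hp⟩
  refine ⟨fun φ hφ₀ hφ₁ hφ => ?_, fun φ hφ hφ₁ => ?_, fun ht => ?_⟩
  · obtain ⟨θ, hθ⟩ := h.exists_equal_thresholds hφ₀ hφ₁ hφ
    exact ⟨θ, ⟨_, hθ, rfl⟩, θ, ⟨_, hθ, rfl⟩, hθ, rfl⟩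
  · rintro _ ⟨p, hp, rfl⟩ _ ⟨q, hq, rfl⟩
    exact (h.lt_commonThreshold_of_mem_optimalPairs hφ hφ₁ hp).1.trans
      (h.lt_commonThreshold_of_mem_optimalPairs hφ hφ₁ hq).2
  · rintro _ ⟨p, ⟨⟨π, hπ, hπφ⟩, -⟩, rfl⟩
    have hα := h.α_pos_of_tippingPoint_lt_one ht
    have hpair : (p.1, P.σ + P.τ) ∈ OpportunityAllocation.optimalPairs P 1 :=
      ⟨⟨π, hπ, hπφ⟩, by
        rw [OpportunityAllocation.matching, Set.mem_ofPred_eq, if_pos rfl]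
        exact ⟨by linarith, le_rfl⟩⟩
    refine ⟨P.σ + P.τ, ⟨_, hpair, rfl⟩, hpair, ?_⟩
    by_contra! hle
    -- At `φ = 1` the capacity must be used within `D`, which the threshold `σ` cannot do.
    have hadm := (hπ.1 1 ⟨zero_le_one, le_rfl⟩).2.2.2
    rw [hπφ, min_eq_right (show P.σ ≤ p.1 by linarith), div_self hσ.ne'] at hadm
    linarith
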